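/- Let $S$ be a set of sorts, let $T=(T,\eta,\mu)$ be a finitary monad on $\mathbf{Set}^S$ (i.e. its functor preserves filtered colimits), let $\mathcal C$ be the variety of Eilenberg--Moore algebras for $T$, and let $F\colon\mathcal C\to\mathcal C$ be an endofunctor preserving sifted colimits. Write $+$ for coproducts in $\mathcal C$. An object of $\mathcal C$ is *ffg* (free finitely generated) if it is isomorphic to $(TX_0,\mu_{X_0})$ for an $S$-sorted set $X_0$ with $\coprod_{s}X_{0,s}$ finite. An *ffg-equation* in $A$ is a morphism $e\colon X\to FX+A$ with $X$ ffg. For $h\colon A\to B$ put $h\bullet e=(FX+h)\cdot e$; for $e\colon X\to FX+Y$ and $f\colon Y\to FY+Z$ put $$e\mathbin{\square} f=\bigl(X+Y\xrightarrow{[e,\mathsf{inr}]}FX+Y\xrightarrow{FX+f}FX+FY+Z\xrightarrow{[F\mathsf{inl},F\mathsf{inr}]+Z}F(X+Y)+Z\bigr).$$ An *ffg-Elgot algebra* for $F$ is a triple $(A,a,\dagger)$ where $a\colon FA\to A$ is an $F$-algebra and $\dagger$ assigns to every ffg-equation $e\colon X\to FX+A$ a solution $e^\dagger\colon X\to A$,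 i.e. $e^\dagger=[a,\mathrm{id}_A]\cdot(Fe^\dagger+A)\cdot e$, such that 1. (Weak Functoriality) for all ffg objects $X,Y,Z$, all $e\colon X\to FX+Z$, $f\colon Y\to FY+Z$ and $m\colon X\to Y$ with $(Fm+Z)\cdot e=f\cdot m$, and every $h\colon Z\to A$, we have $(h\bullet f)^\dagger\cdot m=(h\bullet e)^\dagger$; 2. (Compositionality) for all ffg objects $X,Y$ and all $e\colon X\to FX+Y$, $f\colon Y\to FY+A$, we have $(f^\dagger\bullet e)^\dagger=(e\mathbin{\square} f)^\dagger\cdot\mathsf{inl}$. A morphism $(A,a,\dagger)\to(B,b,\ddagger)$ of ffg-Elgot algebras is a morphism $h\colon A\to B$ of $\mathcal C$ with $(h\bullet e)^\ddagger=h\cdot e^\dagger$ for every ffg-equation $e\colon X\to FX+A$. Then every morphism of ffg-Elgot algebras is a homomorphism of $F$-algebras, so that there is a forgetful functor $W_F\colon(A,a,\dagger)\mapsto(A,a)$ from the category of ffg-Elgot algebras for $F$ to the category of $F$-algebras; and $W_F$ is monadic, i.e. it has a left adjoint and the comparison functor to the category of Eilenberg--Moore algebras for the induced monad on the category of $F$-algebras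 is an equivalence of categories. -/

import Mathlib

open CategoryTheory CategoryTheory.Limits

universe u

namespace FFGElgot

/-! ### Varieties

A (finitary, `S`-sorted) variety is the category `T.Algebra` of Eilenberg-Moore algebras of a
finitary monad `T` on the category `S → Type u` of `S`-sorted sets. We first show that such a
category is cocomplete, so that the coproducts used below exist. -/

section Image

variable {C : Type*} [Category* C] {T : Monad C} {Y X : T.Algebra} {m : Y ⟶ X} {Q : C}
  {q : Y.A ⟶ Q} {i : Q ⟶ X.A} {r : Q ⟶ Y.A}

theorem image_str (hqi : q ≫ i = m.f) (hri : r ≫ q = 𝟙 Q) :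
    (T.map r ≫ Y.a ≫ q) ≫ i = T.map i ≫ X.a := by
  have h : r ≫ m.f = i := by rw [← hqi, reassoc_of% hri]
  rw [Category.assoc, Category.assoc, hqi, ← m.h, ← h, T.map_comp, Category.assoc]

/-- The image of a homomorphism `m` of `T`-algebras whose underlying morphism factorizes as a
split epimorphism `q` followed by a monomorphism `i`. -/
def imageAlg (hqi : q ≫ i = m.f) (hri : r ≫ q = 𝟙 Q) [Mono i] : T.Algebra where
  A := Q
  a := T.map r ≫ Y.a ≫ q
  unit := by
    rw [← cancel_mono i, Category.assoc, image_str hqi hri, ← T.η.naturality_assoc, X.unit]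
    simp
  assoc := by
    have e := image_str (T := T) hqi hri
    rw [← cancel_mono i, Category.assoc (T.μ.app Q), e, ← T.μ.naturality_assoc, X.assoc,
      Functor.comp_map, ← T.map_comp_assoc, ← e, T.map_comp, Category.assoc,
      Category.assoc (T.map (T.map r ≫ Y.a ≫ q)), e]

/-- The inclusion of the image. -/
def imageIncl (hqi : q ≫ i = m.f) (hri : r ≫ q = 𝟙 Q) [Mono i] : imageAlg hqi hri ⟶ X where
  f := i
  h := (image_str hqi hri).symm

/-- A homomorphism into `X` which factorizes through `i` factorizes through the image. -/
def imageLift (hqi : q ≫ i = m.f) (hri : r ≫ q = 𝟙 Q) [Mono i] {Z : T.Algebra} (h : Z ⟶ X)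
    (k : Z.A ⟶ Q) (hk : k ≫ i = h.f) : Z ⟶ imageAlg hqi hri where
  f := k
  h := by
    have e : (imageAlg hqi hri).a ≫ i = T.map i ≫ X.a := image_str hqi hri
    refine (cancel_mono i).1 ?_
    calc (T.map k ≫ (imageAlg hqi hri).a) ≫ i
        = T.map k ≫ ((imageAlg hqi hri).a ≫ i) := Category.assoc _ _ _
      _ = T.map k ≫ (T.map i ≫ X.a) := congrArg (T.map k ≫ ·) e
      _ = Z.a ≫ (k ≫ i) := by rw [← T.map_comp_assoc, hk, h.h]
      _ = (Z.a ≫ k) ≫ i := (Category.assoc _ _ _).symm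

theorem imageLift_incl (hqi : q ≫ i = m.f) (hri : r ≫ q = 𝟙 Q) [Mono i] {Z : T.Algebra}
    (h : Z ⟶ X) (k : Z.A ⟶ Q) (hk : k ≫ i = h.f) :
    imageLift hqi hri h k hk ≫ imageIncl hqi hri = h :=
  Monad.Algebra.Hom.ext hk

end Image

section Cocomplete

variable {S : Type u}

instance hasLimits_sortedSets : HasLimits (S → Type u) where
  has_limits_of_shape _ _ := ⟨fun _ => pi.hasLimit_of_hasLimit_comp_eval⟩

instance hasLimits_algebra (T : Monad (S → Type u)) : HasLimits T.Algebra where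
  has_limits_of_shape _ _ := ⟨fun D => Monad.hasLimit_of_comp_forget_hasLimit D⟩

/-- The quotient of a sorted set by the kernel of a morphism. -/
def kerQuot {Y X : S → Type u} (m : Y ⟶ X) : S → Type u :=
  fun s => Quotient (Setoid.ker (m s))

/-- The quotient map. -/
def kerQuotProj {Y X : S → Type u} (m : Y ⟶ X) : Y ⟶ kerQuot m :=
  fun s => ↾(Quotient.mk (Setoid.ker (m s)))

/-- The induced injection. -/
def kerQuotIncl {Y X : S → Type u} (m : Y ⟶ X) : kerQuot m ⟶ X :=
  fun s => ↾(Quotient.lift (m s) (fun _ _ h => h))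

/-- A section of the quotient map. -/
noncomputable def kerQuotSection {Y X : S → Type u} (m : Y ⟶ X) : kerQuot m ⟶ Y :=
  fun _ => ↾(Quotient.out)

theorem kerQuot_fac {Y X : S → Type u} (m : Y ⟶ X) : kerQuotProj m ≫ kerQuotIncl m = m := by
  funext s; ext x; rfl

theorem kerQuotSection_proj {Y X : S → Type u} (m : Y ⟶ X) :
    kerQuotSection m ≫ kerQuotProj m = 𝟙 _ := by
  funext s; ext x; exact Quotient.out_eq x

instance kerQuotIncl_mono {Y X : S → Type u} (m : Y ⟶ X) : Mono (kerQuotIncl m) where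
  right_cancellation {Z} g h w := by
    funext s
    have : Function.Injective (kerQuotIncl m s) := by
      rintro ⟨x⟩ ⟨y⟩ hxy
      exact Quotient.sound hxy
    ext z
    exact this (ConcreteCategory.congr_hom (congrFun w s) z)

variable {T : Monad (S → Type u)}

theorem solutionSet_const (J : Type u) [SmallCategory J] :
    SolutionSetCondition.{u} (Functor.const J : T.Algebra ⥤ (J ⥤ T.Algebra)) := by
  intro D
  -- the free algebra on the disjoint union of the carriers of the diagram
  let G : S → Type u := fun s => Σ j : J, (D.obj j).A s
  let i₀ : ∀ j, (D.obj j).A ⟶ G := fun j s => ↾(fun x => ⟨j, x⟩)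
  refine ⟨Σ (r : ∀ s, Setoid ((T.free.obj G).A s))
      (a : {a : T.obj (fun s => Quotient (r s)) ⟶ (fun s => Quotient (r s)) //
        T.η.app _ ≫ a = 𝟙 _ ∧ T.μ.app _ ≫ a = T.map a ≫ a}),
      (D ⟶ (Functor.const J).obj (⟨_, a.1, a.2.1, a.2.2⟩ : T.Algebra)),
    fun i => ⟨_, i.2.1.1, i.2.1.2.1, i.2.1.2.2⟩, fun i => i.2.2, ?_⟩
  intro X h
  let g : G ⟶ X.A := fun s => ↾(fun p : G s => (h.app p.1).f s p.2)
  let m : T.free.obj G ⟶ X := (T.adj.homEquiv G X).symm g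
  have hm : T.η.app G ≫ m.f = g := (T.adj.homEquiv G X).apply_symm_apply g
  have hqi := kerQuot_fac m.f
  have hri := kerQuotSection_proj m.f
  let k : ∀ j, (D.obj j).A ⟶ kerQuot m.f := fun j => (i₀ j ≫ T.η.app G) ≫ kerQuotProj m.f
  have hk : ∀ j, k j ≫ kerQuotIncl m.f = (h.app j).f := by
    intro j
    calc k j ≫ kerQuotIncl m.f
        = (i₀ j ≫ T.η.app G) ≫ (kerQuotProj m.f ≫ kerQuotIncl m.f) := Category.assoc _ _ _
      _ = (i₀ j ≫ T.η.app G) ≫ m.f :=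
        congrArg ((i₀ j ≫ T.η.app G) ≫ ·) hqi
      _ = i₀ j ≫ (T.η.app G ≫ m.f) := Category.assoc _ _ _
      _ = i₀ j ≫ g := by rw [hm]
      _ = (h.app j).f := rfl
  have hc := fun j => imageLift_incl hqi hri (h.app j) (k j) (hk j)
  have hmono : Mono (imageIncl hqi hri) := by
    have : Mono ((T.forget).map (imageIncl hqi hri)) := kerQuotIncl_mono m.f
    exact T.forget.mono_of_mono_map this
  let c : D ⟶ (Functor.const J).obj (imageAlg hqi hri) :=
    { app := fun j => imageLift hqi hri (h.app j) (k j) (hk j)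
      naturality := by
        intro j j' f
        refine (cancel_mono (imageIncl hqi hri)).1 ?_
        have := h.naturality f
        simp only [Functor.const_obj_obj, Functor.const_obj_map, Category.comp_id,
          Category.assoc] at this ⊢
        rw [hc, hc, this] }
  refine ⟨⟨fun s => Setoid.ker (m.f s), ⟨(imageAlg hqi hri).a, (imageAlg hqi hri).unit,
    (imageAlg hqi hri).assoc⟩, c⟩, imageIncl hqi hri, ?_⟩
  exact NatTrans.ext (funext hc)

instance hasColimits_algebra : HasColimits T.Algebra where
  has_colimits_of_shape J _ := hasColimitsOfShape_iff_isRightAdjoint_const.2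
    (isRightAdjoint_of_preservesLimits_of_solutionSetCondition _ (solutionSet_const J))

end Cocomplete

/-- A functor preserves sifted colimits if it preserves all colimits whose scheme is a small
sifted category. -/
class PreservesSiftedColimits {C D : Type (u + 1)} [Category.{u} C] [Category.{u} D]
    (F : C ⥤ D) : Prop where
  preserves : ∀ (J : Type u) [SmallCategory J] [IsSifted J], PreservesColimitsOfShape J F

section Definitions

variable {S : Type u} {T : Monad (S → Type u)}

/-- Free finitely generated objects of a variety: those isomorphic to the free algebra
`(T X₀, μ)` on a finite `S`-sorted set `X₀`, i.e. one whose disjoint union of sorts is finite. -/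
def IsFFG (X : T.Algebra) : Prop :=
  ∃ X₀ : S → Type u, Finite (Σ s, X₀ s) ∧ Nonempty (X ≅ T.free.obj X₀)

/-- Sortwise disjoint union is the coproduct of sorted sets. -/
def sumIsColimit (X Y : S → Type u) :
    IsColimit (BinaryCofan.mk (P := fun s => X s ⊕ Y s)
      (fun _ => ↾Sum.inl : X ⟶ _) (fun _ => ↾Sum.inr : Y ⟶ _)) :=
  BinaryCofan.IsColimit.mk _ (fun f g s => ↾(Sum.elim (f s) (g s)))
    (fun _ _ => rfl) (fun _ _ => rfl) (by
      intro Z f g m hf hg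
      subst hf hg
      funext s
      ext x
      rcases x with x | x <;> rfl)

theorem IsFFG.coprod {X Y : T.Algebra} (hX : IsFFG X) (hY : IsFFG Y) : IsFFG (X ⨿ Y) := by
  obtain ⟨X₀, hX₀, ⟨i⟩⟩ := hX
  obtain ⟨Y₀, hY₀, ⟨j⟩⟩ := hY
  refine ⟨fun s => X₀ s ⊕ Y₀ s,
    Finite.of_equiv _ (Equiv.sigmaSumDistrib X₀ Y₀).symm, ⟨?_⟩⟩
  have : PreservesColimit (pair X₀ Y₀) T.free :=
    (T.adj.leftAdjoint_preservesColimits).preservesColimitsOfShape.preservesColimit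
  exact coprod.mapIso i j ≪≫ (coprodIsCoprod _ _).coconePointUniqueUpToIso
    (mapIsColimitOfPreservesOfIsColimit T.free _ _ (sumIsColimit X₀ Y₀))

variable (F : T.Algebra ⥤ T.Algebra)

/-- The equation `h • e = (FX + h) ∘ e : X ⟶ FX + B` obtained from `e : X ⟶ FX + A` by
renaming parameters along `h : A ⟶ B`. -/
noncomputable def renameParams {X A B : T.Algebra} (h : A ⟶ B) (e : X ⟶ F.obj X ⨿ A) :
    X ⟶ F.obj X ⨿ B :=
  e ≫ coprod.map (𝟙 (F.obj X)) h

/-- The combination `e ▪ f : X + Y ⟶ F(X + Y) + Z` of `e : X ⟶ FX + Y` and `f : Y ⟶ FY + Z`: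
it is `[e, inr] : X + Y ⟶ FX + Y`, followed by `FX + f : FX + Y ⟶ FX + (FY + Z)`, followed by
`can + Z`, where `can = [F inl, F inr] : FX + FY ⟶ F(X + Y)`. -/
noncomputable def combine {X Y Z : T.Algebra} (e : X ⟶ F.obj X ⨿ Y) (f : Y ⟶ F.obj Y ⨿ Z) :
    X ⨿ Y ⟶ F.obj (X ⨿ Y) ⨿ Z :=
  coprod.desc e coprod.inr ≫ coprod.map (𝟙 (F.obj X)) f ≫
    (coprod.associator (F.obj X) (F.obj Y) Z).inv ≫
      coprod.map (coprod.desc (F.map coprod.inl) (F.map coprod.inr)) (𝟙 Z)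

/-- An ffg-Elgot algebra `(A, a, †)` for the endofunctor `F`: an `F`-algebra together with an
operation `sol` assigning a solution in `A` to every ffg-equation `e : X ⟶ FX + A`, subject to
Weak Functoriality and Compositionality. -/
structure FFGElgotAlg where
  /-- the underlying `F`-algebra -/
  alg : Endofunctor.Algebra F
  /-- the solution operator `†` -/
  sol : ∀ {X : T.Algebra}, IsFFG X → (X ⟶ F.obj X ⨿ alg.a) → (X ⟶ alg.a)
  /-- `e† = [a, A] ∘ (F e† + A) ∘ e` -/
  isSolution : ∀ {X : T.Algebra} (hX : IsFFG X) (e : X ⟶ F.obj X ⨿ alg.a),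
    sol hX e = e ≫ coprod.map (F.map (sol hX e)) (𝟙 alg.a) ≫ coprod.desc alg.str (𝟙 alg.a)
  /-- Weak Functoriality -/
  weakFunctoriality : ∀ {X Y Z : T.Algebra} (hX : IsFFG X) (hY : IsFFG Y) (_ : IsFFG Z)
    (e : X ⟶ F.obj X ⨿ Z) (f : Y ⟶ F.obj Y ⨿ Z) (m : X ⟶ Y),
    e ≫ coprod.map (F.map m) (𝟙 Z) = m ≫ f →
    ∀ h : Z ⟶ alg.a, m ≫ sol hY (renameParams F h f) = sol hX (renameParams F h e)
  /-- Compositionality -/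
  compositionality : ∀ {X Y : T.Algebra} (hX : IsFFG X) (hY : IsFFG Y)
    (e : X ⟶ F.obj X ⨿ Y) (f : Y ⟶ F.obj Y ⨿ alg.a),
    sol hX (renameParams F (sol hY f) e) = coprod.inl ≫ sol (hX.coprod hY) (combine F e f)

variable {F}

theorem renameParams_id {X A : T.Algebra} (e : X ⟶ F.obj X ⨿ A) :
    renameParams F (𝟙 A) e = e := by
  simp [renameParams]

theorem renameParams_comp {X A B C : T.Algebra} (h : A ⟶ B) (k : B ⟶ C)
    (e : X ⟶ F.obj X ⨿ A) :
    renameParams F (h ≫ k) e = renameParams F k (renameParams F h e) := by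
  simp [renameParams]

/-- A morphism of ffg-Elgot algebras is a morphism of the variety preserving solutions:
`(h • e)‡ = h ∘ e†` for every ffg-equation `e : X ⟶ FX + A`. (Being a homomorphism of
`F`-algebras is not part of the definition.) -/
@[ext]
structure FFGElgotAlg.Hom (A B : FFGElgotAlg F) where
  /-- the underlying morphism of the variety -/
  f : A.alg.a ⟶ B.alg.a
  preservesSol : ∀ {X : T.Algebra} (hX : IsFFG X) (e : X ⟶ F.obj X ⨿ A.alg.a),
    B.sol hX (renameParams F f e) = A.sol hX e ≫ f

/-- The category of ffg-Elgot algebras for `F`. -/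
instance : Category (FFGElgotAlg F) where
  Hom := FFGElgotAlg.Hom
  id A := ⟨𝟙 _, fun hX e => by rw [renameParams_id, Category.comp_id]⟩
  comp g h := ⟨g.f ≫ h.f, fun hX e => by
    rw [renameParams_comp, h.preservesSol, g.preservesSol, Category.assoc]⟩
  id_comp g := FFGElgotAlg.Hom.ext (Category.id_comp g.f)
  comp_id g := FFGElgotAlg.Hom.ext (Category.comp_id g.f)
  assoc g h k := FFGElgotAlg.Hom.ext (Category.assoc g.f h.f k.f)

variable (F)

/-- The assertion that morphisms of ffg-Elgot algebras are homomorphisms of `F`-algebras. -/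
def SolutionPreservingAreHoms : Prop :=
  ∀ {A B : FFGElgotAlg F} (h : A ⟶ B), F.map h.f ≫ B.alg.str = A.alg.str ≫ h.f

variable {F}

/-- The forgetful functor `W_F` from ffg-Elgot algebras to `F`-algebras,
`(A, a, †) ↦ (A, a)` and `h ↦ h`. That it is well defined on morphisms is the assertion `hF`. -/
def forgetToAlgebra (hF : SolutionPreservingAreHoms F) :
    FFGElgotAlg F ⥤ Endofunctor.Algebra F where
  obj A := A.alg
  map h := ⟨h.f, hF h⟩
  map_id _ := rfl
  map_comp _ _ := rfl

end Definitions

end FFGElgot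

/-! Morphisms are homomorphisms because one step of the algebra structure is itself a solution.
Since `F` preserves sifted colimits and `T` is finitary, every element of `FA` has the form `Fp(w)`
with `p : X ⟶ A` and `X` ffg. The equation `applyEquation p k` has solution `[p, a ∘ Fp ∘ k]`,
forced by the solution identity alone, so preserving solutions entails commuting with the structures
(`solutionPreservingAreHoms`).

Monadicity is Beck's theorem. A coequalizer split at the level of `F`-algebras, with quotient `q`
and section `s`, carries the solutions `q ∘ (s • e)†`, and this gives the coequalizer of ffg-Elgot
algebras (`ElgotSplit.isColimit`). Isomorphisms are reflected since an inverse of a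
solution-preserving map preserves solutions.

The left adjoint comes from the general adjoint functor theorem. Limits are formed on carriers. For
the solution set, formal iterated solutions over an algebra `B` form a small sorted set `SolTerm`.
The values of these terms in an ffg-Elgot algebra form a subalgebra closed under solutions, because
an ffg-equation involves only finitely many parameters (`exists_factor_coprod`, `exists_sol_terms`).
So each homomorphism from `B` factorizes through a generated algebra, and the kernel of term
evaluation determines such an algebra (`exists_hom_of_kernel`); there is only a set of kernels. -/

namespace FFGElgot

/-! ### Reflexive coequalizers are sifted colimits -/

section Sifted

open WalkingReflexivePair WalkingReflexivePair.Hom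

/-- A cospan in the walking reflexive pair. -/
abbrev walkingReflexivePairCospan {x y z : WalkingReflexivePair} (a : x ⟶ z) (b : y ⟶ z) :
    StructuredArrow (x, y) (Functor.diag WalkingReflexivePair) :=
  StructuredArrow.mk (T := Functor.diag WalkingReflexivePair) (Y := z) (a, b)

theorem zigzag_comp {x y z w : WalkingReflexivePair} (a : x ⟶ z) (b : y ⟶ z) (g : z ⟶ w) :
    Zigzag (walkingReflexivePairCospan a b) (walkingReflexivePairCospan (a ≫ g) (b ≫ g)) :=
  Zigzag.of_hom (StructuredArrow.homMk g rfl)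

theorem zigzag_left_right {x y : WalkingReflexivePair} (a : x ⟶ .one) (b : y ⟶ .one) :
    Zigzag (walkingReflexivePairCospan (a ≫ left) (b ≫ left))
      (walkingReflexivePairCospan (a ≫ right) (b ≫ right)) :=
  (zigzag_comp a b left).symm.trans (zigzag_comp a b right)

theorem hom_one_zero : ∀ a : WalkingReflexivePair.one ⟶ .zero, a = left ∨ a = right
  | .left => .inl rfl
  | .right => .inr rfl

theorem zigzag_zero : ∀ {x y : WalkingReflexivePair} (a c : x ⟶ .zero) (b d : y ⟶ .zero),
    Zigzag (walkingReflexivePairCospan a b) (walkingReflexivePairCospan c d)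
  | .zero, .zero, .id _, .id _, .id _, .id _ => Zigzag.refl _
  | .one, .zero, a, c, .id _, .id _ => by
    have h := zigzag_left_right (𝟙 WalkingReflexivePair.one) reflexion
    obtain rfl | rfl := hom_one_zero a <;> obtain rfl | rfl := hom_one_zero c <;>
        first | exact Zigzag.refl _ | exact h | exact h.symm
  | .zero, .one, .id _, .id _, b, d => by
    have h := zigzag_left_right reflexion (𝟙 WalkingReflexivePair.one)
    obtain rfl | rfl := hom_one_zero b <;> obtain rfl | rfl := hom_one_zero d <;>
        first | exact Zigzag.refl _ | exact h | exact h.symm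
  | .one, .one, a, c, b, d => by
    -- `leftCompReflexion` followed by either `left` or `right` is `left`, so these three zigzags
    -- join `(left, left)` to the other three pairs.
    have h₁ := zigzag_left_right (𝟙 WalkingReflexivePair.one) (𝟙 WalkingReflexivePair.one)
    have h₂ := zigzag_left_right (𝟙 WalkingReflexivePair.one) leftCompReflexion
    have h₃ := zigzag_left_right leftCompReflexion (𝟙 WalkingReflexivePair.one)
    have h : ∀ a b : WalkingReflexivePair.one ⟶ .zero,
        Zigzag (walkingReflexivePairCospan left left) (walkingReflexivePairCospan a b) := by
      intro a b
      obtain rfl | rfl := hom_one_zero a <;> obtain rfl | rfl := hom_one_zero b <;>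
        first | exact Zigzag.refl _ | exact h₁ | exact h₂ | exact h₃
    exact (h a b).symm.trans (h c d)

theorem exists_hom_zero : ∀ x : WalkingReflexivePair, Nonempty (x ⟶ .zero)
  | .zero => ⟨𝟙 _⟩
  | .one => ⟨left⟩

instance isSifted_walkingReflexivePair : IsSifted WalkingReflexivePair where
  nonempty := ⟨.zero⟩
  out := by
    rintro ⟨x, y⟩
    have : Nonempty (StructuredArrow (x, y) (Functor.diag WalkingReflexivePair)) :=
      ⟨walkingReflexivePairCospan (exists_hom_zero x).some (exists_hom_zero y).some⟩
    refine zigzag_isConnected ?_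
    rintro ⟨⟨⟨⟩⟩, z, a, b⟩ ⟨⟨⟨⟩⟩, w, c, d⟩
    obtain ⟨g⟩ := exists_hom_zero z
    obtain ⟨h⟩ := exists_hom_zero w
    exact (zigzag_comp a b g).trans ((zigzag_zero _ _ _ _).trans (zigzag_comp c d h).symm)

theorem PreservesSiftedColimits.preservesReflexive {C D : Type (u + 1)} [Category.{u} C]
    [Category.{u} D] (F : C ⥤ D) [PreservesSiftedColimits F] :
    PreservesColimitsOfShape WalkingReflexivePair F :=
  have : IsSifted (AsSmall.{u} WalkingReflexivePair) :=
    IsSifted.isSifted_iff_asSmallIsSifted.1 inferInstance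
  have := PreservesSiftedColimits.preserves (F := F) (AsSmall.{u} WalkingReflexivePair)
  preservesColimitsOfShape_of_equiv AsSmall.equiv.symm F

end Sifted

/-! ### Images, generation and finiteness in varieties -/

section Algebra

instance hasColimits_sortedSets {S : Type u} : HasColimits (S → Type u) where
  has_colimits_of_shape _ _ := ⟨fun _ => pi.hasColimit_of_hasColimit_comp_eval⟩

variable {S : Type u} {T : Monad (S → Type u)}

theorem comp_apply {X Y Z : T.Algebra} (f : X ⟶ Y) (g : Y ⟶ Z) (s : S) (x : X.A s) :
    (f ≫ g).f s x = g.f s (f.f s x) :=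
  rfl

theorem apply_of_eq {X Y : T.Algebra} {f g : X ⟶ Y} (h : f = g) (s : S) (x : X.A s) :
    f.f s x = g.f s x := by
  rw [h]

theorem hom_ext_apply {X Y : T.Algebra} {f g : X ⟶ Y} (h : ∀ s x, f.f s x = g.f s x) : f = g :=
  Monad.Algebra.Hom.ext (by funext s; ext x; exact h s x)

/-- The generators of a free algebra. -/
def gen {X : S → Type u} {s : S} (x : X s) : (T.free.obj X).A s :=
  T.η.app X s x

/-- The homomorphism out of a free algebra extending a given sorted function. -/
def freeLift {X : S → Type u} {A : T.Algebra} (g : ∀ s, X s → A.A s) : T.free.obj X ⟶ A :=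
  (T.adj.homEquiv X A).symm (fun s => ↾(g s))

theorem freeLift_gen {X : S → Type u} {A : T.Algebra} (g : ∀ s, X s → A.A s) {s : S} (x : X s) :
    (freeLift (T := T) g).f s (gen x) = g s x :=
  ConcreteCategory.congr_hom
    (congrFun ((T.adj.homEquiv X A).apply_symm_apply (fun s => ↾(g s))) s) x

theorem map_gen {X Y : S → Type u} (i : X ⟶ Y) {s : S} (x : X s) :
    (T.free.map i).f s (gen x) = gen (T := T) (i s x) :=
  have : T.η.app X ≫ T.map i = i ≫ T.η.app Y := (T.η.naturality i).symm
  ConcreteCategory.congr_hom (congrFun this s) x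

theorem free_hom_ext {X : S → Type u} {A : T.Algebra} {f g : T.free.obj X ⟶ A}
    (h : ∀ s (x : X s), f.f s (gen x) = g.f s (gen x)) : f = g := by
  refine (T.adj.homEquiv X A).injective ?_
  funext s
  ext x
  exact h s x

theorem freeLift_comp {X : S → Type u} {A B : T.Algebra} (g : ∀ s, X s → A.A s) (f : A ⟶ B) :
    freeLift g ≫ f = freeLift (T := T) (fun s x => f.f s (g s x)) :=
  free_hom_ext fun s x => by rw [comp_apply, freeLift_gen, freeLift_gen]

theorem map_freeLift {X Y : S → Type u} {A : T.Algebra} (i : X ⟶ Y) (g : ∀ s, Y s → A.A s) :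
    T.free.map i ≫ freeLift g = freeLift (T := T) (fun s x => g s (i s x)) :=
  free_hom_ext fun s x => by rw [comp_apply, map_gen, freeLift_gen, freeLift_gen]

/-- The image of a homomorphism of `T`-algebras. -/
noncomputable abbrev img {P X : T.Algebra} (m : P ⟶ X) : T.Algebra :=
  imageAlg (kerQuot_fac m.f) (kerQuotSection_proj m.f)

/-- The inclusion of the image. -/
noncomputable abbrev imgIncl {P X : T.Algebra} (m : P ⟶ X) : img m ⟶ X :=
  imageIncl (kerQuot_fac m.f) (kerQuotSection_proj m.f)

instance imgIncl_mono {P X : T.Algebra} (m : P ⟶ X) : Mono (imgIncl m) :=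
  have : Mono (T.forget.map (imgIncl m)) := kerQuotIncl_mono m.f
  T.forget.mono_of_mono_map this

theorem imgIncl_mem {P X : T.Algebra} (m : P ⟶ X) (s : S) (z : (img m).A s) :
    ∃ p, m.f s p = (imgIncl m).f s z := by
  obtain ⟨p, rfl⟩ := Quotient.exists_rep z
  exact ⟨p, rfl⟩

theorem exists_lift_img {P X Z : T.Algebra} (m : P ⟶ X) (h : Z ⟶ X)
    (hh : ∀ s z, ∃ p, m.f s p = h.f s z) : ∃ k : Z ⟶ img m, k ≫ imgIncl m = h := by
  choose p hp using hh
  refine ⟨imageLift _ _ h (fun s => ↾(fun z => Quotient.mk _ (p s z))) ?_,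
    imageLift_incl _ _ _ _ _⟩
  funext s
  ext z
  exact hp s z

theorem exists_proj_img {P X : T.Algebra} (m : P ⟶ X) :
    ∃ q : P ⟶ img m, q ≫ imgIncl m = m ∧ ∀ s, Function.Surjective (q.f s) := by
  obtain ⟨q, hq⟩ := exists_lift_img m m fun s z => ⟨z, rfl⟩
  refine ⟨q, hq, fun s z => ?_⟩
  obtain ⟨p, hp⟩ := imgIncl_mem m s z
  refine ⟨p, ?_⟩
  have hi : Function.Injective ((imgIncl m).f s) := by
    rintro ⟨x⟩ ⟨y⟩ hxy
    exact Quotient.sound hxy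
  apply hi
  rw [← hp]
  exact apply_of_eq hq s p

theorem surjective_of_section {P X : T.Algebra} (m : P ⟶ X) (g : X ⟶ img m)
    (hg : g ≫ imgIncl m = 𝟙 X) (s : S) : Function.Surjective (m.f s) := by
  intro x
  obtain ⟨p, hp⟩ := imgIncl_mem m s (g.f s x)
  exact ⟨p, hp.trans (apply_of_eq hg s x)⟩

/-- The legs of the cocone factorize through the image of `m`, so the universal property yields a
section of the image inclusion. -/
theorem surjective_of_isColimit {J : Type*} [Category* J] {D : J ⥤ T.Algebra} {c : Cocone D}
    (hc : IsColimit c) {P : T.Algebra} (m : P ⟶ c.pt)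
    (hm : ∀ j s z, ∃ p, m.f s p = (c.ι.app j).f s z) (s : S) :
    Function.Surjective (m.f s) := by
  choose k hk using fun j => exists_lift_img m (c.ι.app j) (hm j)
  let c' : Cocone D :=
    { pt := img m
      ι := { app := k
             naturality := fun j j' f => by
              rw [← cancel_mono (imgIncl m)]
              simp [hk] } }
  refine surjective_of_section m (hc.desc c') (hc.hom_ext fun j => ?_) s
  rw [hc.fac_assoc, Category.comp_id]
  exact hk j

theorem surjective_coprod {P X Y : T.Algebra} (m : P ⟶ X ⨿ Y)
    (hX : ∀ s x, ∃ p, m.f s p = (coprod.inl : X ⟶ X ⨿ Y).f s x)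
    (hY : ∀ s y, ∃ p, m.f s p = (coprod.inr : Y ⟶ X ⨿ Y).f s y) (s : S) :
    Function.Surjective (m.f s) := by
  obtain ⟨k, hk⟩ := exists_lift_img m _ hX
  obtain ⟨l, hl⟩ := exists_lift_img m _ hY
  exact surjective_of_section m (coprod.desc k l) (by ext1 <;> simp [hk, hl]) s

/-- The characteristic function of the union of the images agrees with the constant `True` on every
leg, hence everywhere. -/
theorem jointly_surjective {J : Type*} [Category* J] {D : J ⥤ (S → Type u)} {c : Cocone D}
    (hc : IsColimit c) (s : S) (x : c.pt s) : ∃ (j : J) (y : D.obj j s), c.ι.app j s y = x := by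
  let p : c.pt ⟶ (fun _ => ULift.{u} Prop) :=
    fun s => ↾(fun x => ⟨∃ (j : J) (y : D.obj j s), c.ι.app j s y = x⟩)
  let q : c.pt ⟶ (fun _ => ULift.{u} Prop) := fun s => ↾(fun _ => ⟨True⟩)
  have h : p = q := hc.hom_ext fun j => by
    funext s
    ext y
    exact iff_of_true ⟨j, y, rfl⟩ trivial
  have := congrArg ULift.down (ConcreteCategory.congr_hom (congrFun h s) x)
  exact this.mpr trivial

/-- The diagram of finite sorted subsets of a sorted set. -/
def finsetDiagram (Z : S → Type u) : Finset (Σ s, Z s) ⥤ (S → Type u) where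
  obj W s := {z : Z s // (⟨s, z⟩ : Σ s, Z s) ∈ W}
  map f s := ↾(fun z => ⟨z.1, leOfHom f z.2⟩)

/-- A sorted set as a cocone over its finite sorted subsets. -/
def finsetCocone (Z : S → Type u) : Cocone (finsetDiagram Z) where
  pt := Z
  ι := { app := fun W s => ↾(fun z => z.1) }

/-- Every sorted set is the directed union of its finite sorted subsets. -/
def finsetCoconeIsColimit (Z : S → Type u) : IsColimit (finsetCocone Z) where
  desc c s := ↾(fun z => c.ι.app {⟨s, z⟩} s ⟨z, Finset.mem_singleton_self _⟩)
  fac c W := by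
    funext s
    ext ⟨z, hz⟩
    have := c.w (homOfLE (Finset.singleton_subset_iff.2 hz) : {⟨s, z⟩} ⟶ W)
    exact (ConcreteCategory.congr_hom (congrFun this s)
      ⟨z, Finset.mem_singleton_self _⟩).symm
  uniq c m hm := by
    funext s
    ext z
    exact ConcreteCategory.congr_hom (congrFun (hm {⟨s, z⟩}) s)
      ⟨z, Finset.mem_singleton_self _⟩

theorem finite_finsetDiagram (Z : S → Type u) (W : Finset (Σ s, Z s)) :
    Finite (Σ s, (finsetDiagram Z).obj W s) :=
  Finite.of_injective (fun z => (⟨⟨z.1, z.2.1⟩, z.2.2⟩ : W)) (by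
    rintro ⟨s, z, hz⟩ ⟨t, w, hw⟩ h
    simp only [Subtype.mk.injEq, Sigma.mk.injEq] at h
    obtain ⟨rfl, h⟩ := h
    obtain rfl := eq_of_heq h
    rfl)

/-- A sorted set is the directed union of its finite subsets, and this colimit survives the free
functor (a left adjoint), `F` (filtered implies sifted) and the forgetful functor (`T` is finitary).
-/
theorem exists_finite_of_free [PreservesFilteredColimits T.toFunctor]
    (F : T.Algebra ⥤ T.Algebra) [PreservesSiftedColimits F] (Z : S → Type u) (s : S)
    (z : (F.obj (T.free.obj Z)).A s) :
    ∃ (W : S → Type u) (_ : Finite (Σ s, W s)) (i : W ⟶ Z) (w : (F.obj (T.free.obj W)).A s),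
      (F.map (T.free.map i)).f s w = z := by
  classical
  have := IsFiltered.isSifted (C := Finset (Σ s, Z s))
  have := PreservesSiftedColimits.preserves (F := F) (Finset (Σ s, Z s))
  have := T.adj.leftAdjoint_preservesColimits
  have : PreservesColimitsOfShape (Finset (Σ s, Z s)) T.toFunctor := inferInstance
  have := Monad.forgetCreatesColimitsOfShape (J := Finset (Σ s, Z s)) (T := T)
  have : PreservesColimitsOfShape (Finset (Σ s, Z s)) T.forget := inferInstance
  have h : IsColimit (T.forget.mapCocone (F.mapCocone (T.free.mapCocone (finsetCocone Z)))) :=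
    isColimitOfPreserves T.forget
      (isColimitOfPreserves F (isColimitOfPreserves T.free (finsetCoconeIsColimit Z)))
  obtain ⟨W, w, hw⟩ := jointly_surjective h s z
  exact ⟨(finsetDiagram Z).obj W, finite_finsetDiagram Z W, (finsetCocone Z).ι.app W, w, hw⟩

/-- `F` preserves the canonical presentation of `A` as a reflexive coequalizer of free algebras. -/
theorem surjective_map_freeCoequalizer_π
    (F : T.Algebra ⥤ T.Algebra) [PreservesSiftedColimits F] (A : T.Algebra) (s : S) :
    Function.Surjective ((F.map (Monad.FreeCoequalizer.π A)).f s) := by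
  have := PreservesSiftedColimits.preservesReflexive F
  let D := ofIsReflexivePair (Monad.FreeCoequalizer.topMap A) (Monad.FreeCoequalizer.bottomMap A)
  let G : ReflexiveCofork D :=
    ReflexiveCofork.mk (Monad.FreeCoequalizer.π A) (Monad.FreeCoequalizer.condition A)
  have hG : IsColimit G :=
    ReflexiveCofork.isColimitEquiv D G (Monad.beckAlgebraCoequalizer A)
  refine surjective_of_isColimit (isColimitOfPreserves F hG) (F.map (Monad.FreeCoequalizer.π A))
    (fun j s z => ?_) s
  cases j with
  | zero => exact ⟨z, rfl⟩
  | one =>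
    refine ⟨(F.map (Monad.FreeCoequalizer.topMap A)).f s z, ?_⟩
    have : F.map (Monad.FreeCoequalizer.topMap A) ≫ F.map (Monad.FreeCoequalizer.π A) =
      F.map (G.ι.app .one) := (F.map_comp _ _).symm
    exact apply_of_eq this s z

instance preservesSiftedColimits_id : PreservesSiftedColimits (𝟭 T.Algebra) where
  preserves _ := inferInstance

variable [PreservesFilteredColimits T.toFunctor]

theorem exists_finite_of_map (F : T.Algebra ⥤ T.Algebra) [PreservesSiftedColimits F]
    (A : T.Algebra) (s : S) (z : (F.obj A).A s) :
    ∃ (W : S → Type u) (_ : Finite (Σ s, W s)) (p : T.free.obj W ⟶ A)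
      (w : (F.obj (T.free.obj W)).A s), (F.map p).f s w = z := by
  obtain ⟨z, rfl⟩ := surjective_map_freeCoequalizer_π F A s z
  obtain ⟨W, hW, i, w, rfl⟩ := exists_finite_of_free F A.A s z
  refine ⟨W, hW, T.free.map i ≫ Monad.FreeCoequalizer.π A, w, ?_⟩
  rw [F.map_comp]
  rfl

/-- `P ⨿ A` is a quotient of the free algebra on the elements of `P` together with `Z`, and each
element of that free algebra uses finitely many generators. -/
theorem exists_finite_of_coprod (P : T.Algebra) {A : T.Algebra} {Z : S → Type u}
    {m : T.free.obj Z ⟶ A} (hm : ∀ s, Function.Surjective (m.f s)) (s : S) (z : (P ⨿ A).A s) :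
    ∃ (W : S → Type u) (_ : Finite (Σ s, W s)) (i : W ⟶ Z) (w : (P ⨿ T.free.obj W).A s),
      (coprod.map (𝟙 P) (T.free.map i ≫ m)).f s w = z := by
  let Y : S → Type u := fun s => P.A s ⊕ Z s
  let g : ∀ s, Y s → (P ⨿ A).A s := fun s =>
    Sum.elim ((coprod.inl : P ⟶ P ⨿ A).f s) (fun z => (m ≫ (coprod.inr : A ⟶ P ⨿ A)).f s (gen z))
  let inr : Z ⟶ Y := fun s => ↾Sum.inr
  have hg : T.free.map inr ≫ freeLift g = m ≫ coprod.inr := by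
    rw [map_freeLift]
    exact free_hom_ext fun s x => freeLift_gen _ _
  obtain ⟨z, rfl⟩ := surjective_coprod (freeLift g) (fun s x => ⟨_, freeLift_gen g (Sum.inl x)⟩)
    (fun s x => by
      obtain ⟨t, rfl⟩ := hm s x
      exact ⟨(T.free.map inr).f s t, apply_of_eq hg s t⟩) s z
  obtain ⟨W, hW, i, w, rfl⟩ := exists_finite_of_free (𝟭 _) Y s z
  -- Only the generators from `Z` are kept as parameters; those from `P` are interpreted directly in
  -- the left summand.
  let V : S → Type u := fun s => {w : W s // ∃ a, i s w = Sum.inr a}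
  have hV : Finite (Σ s, V s) :=
    Finite.of_injective (β := Σ s, W s) (Sigma.map id fun _ => Subtype.val)
      (Function.injective_id.sigma_map fun _ => Subtype.val_injective)
  let j : V ⟶ Z := fun s => ↾(fun w => w.2.choose)
  have hk : ∀ s x, ∃ y, (coprod.map (𝟙 P) (T.free.map j ≫ m)).f s y = g s (i s x) := by
    intro s x
    rcases h : i s x with a | a
    · refine ⟨(coprod.inl : P ⟶ P ⨿ _).f s a, ?_⟩
      rw [← comp_apply, coprod.inl_map, Category.id_comp]
      rfl
    · let v : V s := ⟨x, a, h⟩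
      have ha : j s v = a := Sum.inr.inj (v.2.choose_spec.symm.trans h)
      refine ⟨(coprod.inr : _ ⟶ P ⨿ _).f s (gen v), ?_⟩
      rw [← comp_apply, coprod.inr_map, comp_apply, comp_apply, map_gen, ha]
      rfl
  choose k hk using hk
  refine ⟨V, hV, j, (freeLift k).f s w, ?_⟩
  rw [← comp_apply, freeLift_comp]
  refine (apply_of_eq ?_ s w).trans (comp_apply (T.free.map i) (freeLift g) s w)
  rw [map_freeLift]
  exact congrArg freeLift (funext fun s => funext (hk s))

end Algebra
-- Codes for ffg objects and finiteness of parameters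
/-- A finite list of sorts, as a code for a finite sorted set. -/
abbrev Arity (S : Type u) : Type u :=
  Σ n : ℕ, Fin n → S

section Arity

variable {S : Type u} {T : Monad (S → Type u)}

/-- The finite sorted set coded by a list of sorts. -/
def Arity.set (c : Arity S) : S → Type u :=
  fun s => ULift {i : Fin c.1 // c.2 i = s}

instance finite_arity (c : Arity S) : Finite (Σ s, c.set s) :=
  Finite.of_injective (fun x => x.2.down.1) (by
    rintro ⟨s, ⟨i, rfl⟩⟩ ⟨t, ⟨j, rfl⟩⟩ (rfl : i = j)
    rfl)

theorem isFFG_free {X : S → Type u} (hX : Finite (Σ s, X s)) : IsFFG (T.free.obj X) :=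
  ⟨X, hX, ⟨Iso.refl _⟩⟩

theorem exists_arity_iso (X : S → Type u) [Finite (Σ s, X s)] :
    ∃ c : Arity S, Nonempty (c.set ≅ X) := by
  obtain ⟨n, ⟨e⟩⟩ := Finite.exists_equiv_fin (Σ s, X s)
  let c : Arity S := ⟨n, fun i => (e.symm i).1⟩
  have h : ∀ {s : S} (p : Σ s, X s) (hp : p.1 = s), (⟨s, hp ▸ p.2⟩ : Σ s, X s) = p := by
    rintro _ p rfl
    rfl
  refine ⟨c, ⟨⟨fun s => ↾(fun i => i.down.2 ▸ (e.symm i.down.1).2),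
    fun s => ↾(fun x => ⟨e ⟨s, x⟩, by simp [c]⟩), ?_, ?_⟩⟩⟩
  · funext s
    ext ⟨i, hi⟩
    refine congrArg ULift.up (Subtype.ext ?_)
    exact (congrArg e (h (e.symm i) hi)).trans (e.apply_symm_apply i)
  · funext s
    ext x
    exact eq_of_heq (Sigma.mk.inj ((h (e.symm (e ⟨s, x⟩)) _).trans (e.symm_apply_apply _))).2

/-- This gives a small set of representatives of the ffg objects, which lets iteration terms form
sets in `Type u`. -/
theorem IsFFG.exists_arity {X : T.Algebra} (hX : IsFFG X) :
    ∃ c : Arity S, Nonempty (X ≅ T.free.obj c.set) := by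
  obtain ⟨X₀, hX₀, ⟨i⟩⟩ := hX
  obtain ⟨c, ⟨j⟩⟩ := exists_arity_iso X₀
  exact ⟨c, ⟨i ≪≫ T.free.mapIso j.symm⟩⟩

/-- The free algebra on one generator. -/
abbrev freeOne (T : Monad (S → Type u)) (s : S) : T.Algebra :=
  T.free.obj (Arity.set ⟨1, fun _ => s⟩)

/-- An element of an algebra as a homomorphism. -/
def elt {A : T.Algebra} {s : S} (a : A.A s) : freeOne T s ⟶ A :=
  freeLift fun _ i => i.down.2 ▸ a

theorem exists_elt (T : Monad (S → Type u)) (s : S) :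
    ∃ z : (freeOne T s).A s, ∀ (A : T.Algebra) (a : A.A s), (elt a).f s z = a :=
  ⟨gen ⟨0, rfl⟩, fun _ _ => freeLift_gen _ _⟩

variable [PreservesFilteredColimits T.toFunctor]

theorem exists_ffg_of_map (F : T.Algebra ⥤ T.Algebra) [PreservesSiftedColimits F]
    (A : T.Algebra) (s : S) (z : (F.obj A).A s) :
    ∃ (X : T.Algebra) (_ : IsFFG X) (p : X ⟶ A) (w : (F.obj X).A s), (F.map p).f s w = z := by
  obtain ⟨W, hW, p, w, h⟩ := exists_finite_of_map F A s z
  exact ⟨_, isFFG_free hW, p, w, h⟩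

/-- Each of the finitely many generators of `X` needs only finitely many parameters; their disjoint
union serves for `e`. -/
theorem exists_factor_coprod {X : T.Algebra} (hX : IsFFG X) {P A : T.Algebra} {Z : S → Type u}
    {m : T.free.obj Z ⟶ A} (hm : ∀ s, Function.Surjective (m.f s)) (e : X ⟶ P ⨿ A) :
    ∃ (c : Arity S) (i : c.set ⟶ Z) (e₀ : X ⟶ P ⨿ T.free.obj c.set),
      e₀ ≫ coprod.map (𝟙 P) (T.free.map i ≫ m) = e := by
  obtain ⟨X₀, hX₀, ⟨j⟩⟩ := hX
  choose W hW p w hw using fun x : Σ s, X₀ s =>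
    exists_finite_of_coprod P hm x.1 ((j.inv ≫ e).f x.1 (gen x.2))
  let V : S → Type u := fun s => Σ x, W x s
  have hV : Finite (Σ s, V s) := Finite.of_injective (β := Σ x, Σ s, W x s)
    (fun v => ⟨v.2.1, v.1, v.2.2⟩) (by
      rintro ⟨s, x, v⟩ ⟨t, y, v'⟩ h
      cases h
      rfl)
  let i : ∀ x, W x ⟶ V := fun x s => ↾(fun v => ⟨x, v⟩)
  let q : V ⟶ Z := fun s => ↾(fun v => p v.1 s v.2)
  obtain ⟨c, ⟨k⟩⟩ := exists_arity_iso V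
  refine ⟨c, k.hom ≫ q, j.hom ≫ freeLift fun s x =>
    (coprod.map (𝟙 P) (T.free.map (i ⟨s, x⟩ ≫ k.inv))).f s (w ⟨s, x⟩), ?_⟩
  rw [Category.assoc, ← Iso.eq_inv_comp, freeLift_comp]
  refine free_hom_ext fun s x => ?_
  have hk : T.free.map (i ⟨s, x⟩ ≫ k.inv) ≫ T.free.map (k.hom ≫ q) ≫ m =
      T.free.map (p ⟨s, x⟩) ≫ m := by
    rw [← T.free.map_comp_assoc, Category.assoc, k.inv_hom_id_assoc]
    rfl
  rw [freeLift_gen, ← comp_apply, coprod.map_map, hk, Category.comp_id]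
  exact hw ⟨s, x⟩

end Arity

/-! ### Solution-preserving morphisms are homomorphisms -/

section Elgot

variable {S : Type u} {T : Monad (S → Type u)} {F : T.Algebra ⥤ T.Algebra}

theorem renameParams_combine {X Y Z Z' : T.Algebra} (e : X ⟶ F.obj X ⨿ Y) (f : Y ⟶ F.obj Y ⨿ Z)
    (h : Z ⟶ Z') :
    renameParams F h (combine F e f) = combine F e (renameParams F h f) := by
  simp only [renameParams, combine, Category.assoc]
  congr 1
  ext1 <;> simp

/-- The equation with solution `[p, k ≫ F p ≫ a]`. -/
noncomputable def applyEquation {X Y A : T.Algebra} (p : X ⟶ A) (k : Y ⟶ F.obj X) :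
    X ⨿ Y ⟶ F.obj (X ⨿ Y) ⨿ A :=
  coprod.desc (p ≫ coprod.inr) (k ≫ F.map coprod.inl ≫ coprod.inl)

theorem inl_applyEquation {X Y A : T.Algebra} (p : X ⟶ A) (k : Y ⟶ F.obj X) :
    coprod.inl ≫ applyEquation p k = p ≫ coprod.inr :=
  coprod.inl_desc _ _

theorem inr_applyEquation {X Y A : T.Algebra} (p : X ⟶ A) (k : Y ⟶ F.obj X) :
    coprod.inr ≫ applyEquation p k = k ≫ F.map coprod.inl ≫ coprod.inl :=
  coprod.inr_desc _ _

theorem renameParams_applyEquation {X Y A B : T.Algebra} (p : X ⟶ A) (k : Y ⟶ F.obj X)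
    (h : A ⟶ B) : renameParams F h (applyEquation p k) = applyEquation (p ≫ h) k := by
  ext1 <;> simp [renameParams, applyEquation]

theorem FFGElgotAlg.inl_sol_applyEquation (A : FFGElgotAlg F) {X Y : T.Algebra} (hX : IsFFG X)
    (hY : IsFFG Y) (p : X ⟶ A.alg.a) (k : Y ⟶ F.obj X) :
    coprod.inl ≫ A.sol (hX.coprod hY) (applyEquation p k) = p := by
  rw [A.isSolution, reassoc_of% inl_applyEquation, coprod.inr_map_assoc, Category.id_comp,
    coprod.inr_desc, Category.comp_id]

theorem FFGElgotAlg.inr_sol_applyEquation (A : FFGElgotAlg F) {X Y : T.Algebra} (hX : IsFFG X)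
    (hY : IsFFG Y) (p : X ⟶ A.alg.a) (k : Y ⟶ F.obj X) :
    coprod.inr ≫ A.sol (hX.coprod hY) (applyEquation p k) = k ≫ F.map p ≫ A.alg.str := by
  rw [A.isSolution, reassoc_of% inr_applyEquation, coprod.inl_map_assoc, coprod.inl_desc,
    ← F.map_comp_assoc, A.inl_sol_applyEquation hX hY]

variable [PreservesFilteredColimits T.toFunctor] [PreservesSiftedColimits F]

theorem solutionPreservingAreHoms : SolutionPreservingAreHoms F := by
  intro A B h
  refine hom_ext_apply fun s z => ?_
  obtain ⟨X, hX, p, w, rfl⟩ := exists_ffg_of_map F A.alg.a s z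
  obtain ⟨t, ht⟩ := exists_elt T s
  have hY : IsFFG (freeOne T s) := isFFG_free inferInstance
  -- The right component of the solution is the structure map applied to `F.map p` of `w`.
  have key := congrArg (coprod.inr ≫ ·) (h.preservesSol (hX.coprod hY) (applyEquation p (elt w)))
  rw [renameParams_applyEquation, B.inr_sol_applyEquation hX hY, ← Category.assoc coprod.inr,
    A.inr_sol_applyEquation hX hY] at key
  have := apply_of_eq key s t
  simp only [comp_apply, ht, F.map_comp] at this
  exact this

end Elgot
-- Limits of ffg-Elgot algebras
section Elgot

variable {S : Type u} {T : Monad (S → Type u)} {F : T.Algebra ⥤ T.Algebra}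

theorem elgot_hom_ext {A B : FFGElgotAlg F} {g h : A ⟶ B} (w : g.f = h.f) : g = h :=
  FFGElgotAlg.Hom.ext w

theorem solution_comp {A B : Endofunctor.Algebra F} (f : A ⟶ B) {X : T.Algebra}
    (e : X ⟶ F.obj X ⨿ A.a) (s : X ⟶ A.a) :
    (e ≫ coprod.map (F.map s) (𝟙 A.a) ≫ coprod.desc A.str (𝟙 A.a)) ≫ f.f =
      renameParams F f.f e ≫ coprod.map (F.map (s ≫ f.f)) (𝟙 B.a) ≫
        coprod.desc B.str (𝟙 B.a) := by
  simp only [renameParams, Category.assoc, coprod.map_desc, coprod.desc_comp, F.map_comp, f.h,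
    Category.id_comp, Category.comp_id]

/-- A jointly monic family of `F`-algebra homomorphisms into ffg-Elgot algebras whose domain is
closed under solutions makes the domain an ffg-Elgot algebra. -/
def FFGElgotAlg.ofJointlyMono (U : Endofunctor.Algebra F) {ι : Type*} (A : ι → FFGElgotAlg F)
    (f : ∀ j, U ⟶ (A j).alg)
    (hf : ∀ {X : T.Algebra} (g h : X ⟶ U.a), (∀ j, g ≫ (f j).f = h ≫ (f j).f) → g = h)
    (sol : ∀ {X : T.Algebra}, IsFFG X → (X ⟶ F.obj X ⨿ U.a) → (X ⟶ U.a))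
    (hsol : ∀ {X : T.Algebra} (hX : IsFFG X) (e : X ⟶ F.obj X ⨿ U.a) (j : ι),
      sol hX e ≫ (f j).f = (A j).sol hX (renameParams F (f j).f e)) :
    FFGElgotAlg F where
  alg := U
  sol := sol
  isSolution hX e := hf _ _ fun j => by
    rw [solution_comp, hsol]
    exact (A j).isSolution hX _
  weakFunctoriality hX hY hZ e e' m w h := hf _ _ fun j => by
    rw [Category.assoc, hsol, hsol, ← renameParams_comp, ← renameParams_comp]
    exact (A j).weakFunctoriality hX hY hZ e e' m w _
  compositionality hX hY e e' := hf _ _ fun j => by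
    rw [Category.assoc, hsol, hsol, ← renameParams_comp, hsol, renameParams_combine]
    exact (A j).compositionality hX hY e _

/-- Weak Functoriality along an isomorphism. It requires an ffg parameter object `Z`, so general
equations must first be factored through finitely many parameters. -/
theorem FFGElgotAlg.sol_iso (A : FFGElgotAlg F) {X Y Z : T.Algebra} (hX : IsFFG X)
    (hY : IsFFG Y) (hZ : IsFFG Z) (e : X ⟶ F.obj X ⨿ Z) (i : X ≅ Y) (h : Z ⟶ A.alg.a) :
    A.sol hX (renameParams F h e) =
      i.hom ≫ A.sol hY (renameParams F h (i.inv ≫ e ≫ coprod.map (F.map i.hom) (𝟙 Z))) :=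
  (A.weakFunctoriality hX hY hZ e _ i.hom (by simp) h).symm

section Limits

variable {J : Type u} [SmallCategory J] (K : J ⥤ FFGElgotAlg F)

/-- A limit of the carriers of a diagram of ffg-Elgot algebras. -/
structure CarrierLimit where
  /-- the limit object -/
  L : T.Algebra
  /-- the limit projections -/
  p : ∀ j, L ⟶ (K.obj j).alg.a
  w : ∀ {j j' : J} (g : j ⟶ j'), p j ≫ (K.map g).f = p j'
  /-- the universal morphism -/
  lift : ∀ {X : T.Algebra} (f : ∀ j, X ⟶ (K.obj j).alg.a),
    (∀ (j j' : J) (g : j ⟶ j'), f j ≫ (K.map g).f = f j') → (X ⟶ L)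
  fac : ∀ {X : T.Algebra} (f : ∀ j, X ⟶ (K.obj j).alg.a)
    (hf : ∀ (j j' : J) (g : j ⟶ j'), f j ≫ (K.map g).f = f j') (j : J), lift f hf ≫ p j = f j
  ext : ∀ {X : T.Algebra} {g h : X ⟶ L}, (∀ j, g ≫ p j = h ≫ p j) → g = h

/-- The diagram of carriers of a diagram of ffg-Elgot algebras. -/
def carrierDiagram : J ⥤ T.Algebra where
  obj j := (K.obj j).alg.a
  map g := (K.map g).f
  map_id j := by rw [K.map_id]; rfl
  map_comp g h := by rw [K.map_comp]; rfl

/-- Limits of carriers exist. -/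
noncomputable def carrierLimit : CarrierLimit K where
  L := limit (carrierDiagram K)
  p := limit.π (carrierDiagram K)
  w := limit.w (carrierDiagram K)
  lift {X} f hf := limit.lift (carrierDiagram K)
    { pt := X
      π := { app := f
             naturality := fun _ _ g => (Category.id_comp _).trans (hf _ _ g).symm } }
  fac _ _ := limit.lift_π _
  ext := limit.hom_ext

variable {K} (hF : SolutionPreservingAreHoms F)

namespace CarrierLimit

variable (l : CarrierLimit K)

/-- The `F`-algebra structure on the limit of carriers. -/
abbrev algebra : Endofunctor.Algebra F where
  a := l.L
  str := l.lift (fun j => F.map (l.p j) ≫ (K.obj j).alg.str) fun _ _ g => by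
    rw [Category.assoc, ← hF (K.map g), ← F.map_comp_assoc, l.w]

theorem algebra_str (j : J) :
    (l.algebra hF).str ≫ l.p j = F.map (l.p j) ≫ (K.obj j).alg.str :=
  l.fac (fun j => F.map (l.p j) ≫ (K.obj j).alg.str) _ j

/-- The limit projections as homomorphisms of `F`-algebras. -/
abbrev proj (j : J) : l.algebra hF ⟶ (K.obj j).alg where
  f := l.p j
  h := (l.algebra_str hF j).symm

/-- Solutions in the limit are computed componentwise. -/
noncomputable def solution {X : T.Algebra} (hX : IsFFG X) (e : X ⟶ F.obj X ⨿ l.L) : X ⟶ l.L :=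
  l.lift (fun j => (K.obj j).sol hX (renameParams F (l.p j) e)) fun _ _ g => by
    rw [← (K.map g).preservesSol, ← renameParams_comp, l.w]

theorem solution_p {X : T.Algebra} (hX : IsFFG X) (e : X ⟶ F.obj X ⨿ l.L) (j : J) :
    l.solution hX e ≫ l.p j = (K.obj j).sol hX (renameParams F (l.p j) e) :=
  l.fac (fun j => (K.obj j).sol hX (renameParams F (l.p j) e)) _ j

theorem solution_lift {Q : FFGElgotAlg F} (f : ∀ j, Q ⟶ K.obj j)
    (hf : ∀ (j j' : J) (g : j ⟶ j'), (f j).f ≫ (K.map g).f = (f j').f)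
    {X : T.Algebra} (hX : IsFFG X) (e : X ⟶ F.obj X ⨿ Q.alg.a) :
    l.solution hX (renameParams F (l.lift (fun j => (f j).f) hf) e) =
      Q.sol hX e ≫ l.lift (fun j => (f j).f) hf :=
  l.ext fun j => by
    rw [solution_p, Category.assoc, l.fac, ← (f j).preservesSol, ← renameParams_comp, l.fac]

theorem str_lift {Q : Endofunctor.Algebra F} (f : ∀ j, Q ⟶ (K.obj j).alg)
    (hf : ∀ (j j' : J) (g : j ⟶ j'), (f j).f ≫ (K.map g).f = (f j').f)
    {k : F.obj l.L ⟶ l.L} (hk : ∀ j, k ≫ l.p j = F.map (l.p j) ≫ (K.obj j).alg.str) :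
    F.map (l.lift (fun j => (f j).f) hf) ≫ k = Q.str ≫ l.lift (fun j => (f j).f) hf :=
  l.ext fun j => by
    rw [Category.assoc, Category.assoc, l.fac, hk, ← F.map_comp_assoc, l.fac, (f j).h]

/-- The limit of a diagram of ffg-Elgot algebras. -/
noncomputable abbrev elgot : FFGElgotAlg F :=
  FFGElgotAlg.ofJointlyMono (l.algebra hF) K.obj (l.proj hF) (fun _ _ h => l.ext fun j => h j)
    l.solution l.solution_p

/-- The limit cone of a diagram of ffg-Elgot algebras. -/
noncomputable abbrev cone : Cone K where
  pt := l.elgot hF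
  π :=
    { app := fun j => ⟨l.p j, fun hX e => (l.solution_p hX e j).symm⟩
      naturality := fun _ _ g => elgot_hom_ext ((Category.id_comp _).trans (l.w g).symm) }

theorem cone_w (c : Cone K) (j j' : J) (g : j ⟶ j') :
    (c.π.app j).f ≫ (K.map g).f = (c.π.app j').f :=
  congrArg FFGElgotAlg.Hom.f (c.w g)

/-- The limit cone is a limit cone. -/
noncomputable def coneIsLimit : IsLimit (l.cone hF) where
  lift c :=
    { f := l.lift (fun j => (c.π.app j).f) (cone_w c)
      preservesSol := l.solution_lift c.π.app (cone_w c) }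
  fac c j := elgot_hom_ext (l.fac (X := c.pt.alg.a) (fun j => (c.π.app j).f) (cone_w c) j)
  uniq c _ h := elgot_hom_ext <| l.ext fun j =>
    (congrArg FFGElgotAlg.Hom.f (h j)).trans
      (l.fac (X := c.pt.alg.a) (fun j => (c.π.app j).f) (cone_w c) j).symm

theorem forget_cone_w (c : Cone (K ⋙ forgetToAlgebra hF)) (j j' : J) (g : j ⟶ j') :
    (c.π.app j).f ≫ (K.map g).f = (c.π.app j').f :=
  congrArg Endofunctor.Algebra.Hom.f (c.w g)

/-- The underlying cone of `F`-algebras is a limit cone. -/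
noncomputable def mapConeIsLimit : IsLimit ((forgetToAlgebra hF).mapCone (l.cone hF)) where
  lift c :=
    { f := l.lift (fun j => (c.π.app j).f) (forget_cone_w hF c)
      h := l.str_lift c.π.app (forget_cone_w hF c) (l.algebra_str hF) }
  fac c j := Endofunctor.Algebra.ext
    (l.fac (X := c.pt.a) (fun j => (c.π.app j).f) (forget_cone_w hF c) j)
  uniq c _ h := Endofunctor.Algebra.ext <| l.ext fun j =>
    (congrArg Endofunctor.Algebra.Hom.f (h j)).trans
      (l.fac (X := c.pt.a) (fun j => (c.π.app j).f) (forget_cone_w hF c) j).symm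

end CarrierLimit

end Limits

theorem hasLimits_elgot (hF : SolutionPreservingAreHoms F) : HasLimits (FFGElgotAlg F) where
  has_limits_of_shape _ _ := ⟨fun K => ⟨⟨⟨_, (carrierLimit K).coneIsLimit hF⟩⟩⟩⟩

theorem preservesLimits_forgetToAlgebra (hF : SolutionPreservingAreHoms F) :
    PreservesLimits (forgetToAlgebra hF) where
  preservesLimitsOfShape := ⟨fun {K} =>
    preservesLimit_of_preserves_limit_cone ((carrierLimit K).coneIsLimit hF)
      ((carrierLimit K).mapConeIsLimit hF)⟩

end Elgot
-- Split coequalizers and Beck's theorem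
section Beck

variable {S : Type u} {T : Monad (S → Type u)} {F : T.Algebra ⥤ T.Algebra}

/-- The data of a split coequalizer of `F`-algebras of a pair of morphisms of ffg-Elgot
algebras. -/
structure ElgotSplit {A B : FFGElgotAlg F} (f g : A ⟶ B) (Q : Endofunctor.Algebra F) where
  /-- the coequalizer -/
  q : B.alg ⟶ Q
  /-- its section -/
  s : Q ⟶ B.alg
  /-- the section of the first morphism -/
  t : B.alg ⟶ A.alg
  condition : f.f ≫ q.f = g.f ≫ q.f
  s_q : s.f ≫ q.f = 𝟙 _
  t_g : t.f ≫ g.f = 𝟙 _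
  t_f : t.f ≫ f.f = q.f ≫ s.f

namespace ElgotSplit

variable {A B : FFGElgotAlg F} {f g : A ⟶ B} {Q : Endofunctor.Algebra F} (σ : ElgotSplit f g Q)

/-- Renaming along `s ∘ q = f ∘ t` can be traded for renaming along `g ∘ t = id`: both `f` and `g`
preserve solutions and `q` identifies them. -/
theorem sol_q {X : T.Algebra} (hX : IsFFG X) (e : X ⟶ F.obj X ⨿ B.alg.a) :
    B.sol hX (renameParams F σ.s.f (renameParams F σ.q.f e)) ≫ σ.q.f = B.sol hX e ≫ σ.q.f := by
  rw [← renameParams_comp, ← σ.t_f, renameParams_comp, f.preservesSol, Category.assoc,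
    σ.condition, ← Category.assoc, ← g.preservesSol, ← renameParams_comp, σ.t_g,
    renameParams_id]

/-- The ffg-Elgot algebra structure on a split coequalizer. -/
noncomputable def elgot : FFGElgotAlg F where
  alg := Q
  sol hX e := B.sol hX (renameParams F σ.s.f e) ≫ σ.q.f
  isSolution hX e := by
    conv_lhs => rw [B.isSolution, solution_comp, ← renameParams_comp, σ.s_q, renameParams_id]
  weakFunctoriality hX hY hZ e e' m w h := by
    rw [← renameParams_comp, ← renameParams_comp, ← Category.assoc,
      B.weakFunctoriality hX hY hZ e e' m w]
  compositionality hX hY e e' := by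
    rw [renameParams_comp (B.sol hY _) σ.q.f, σ.sol_q, B.compositionality hX hY,
      renameParams_combine, Category.assoc]

/-- The quotient morphism onto the split coequalizer. -/
noncomputable def π : B ⟶ σ.elgot where
  f := σ.q.f
  preservesSol := σ.sol_q

theorem comp_π : f ≫ σ.π = g ≫ σ.π :=
  elgot_hom_ext σ.condition

theorem q_s_comp {D : FFGElgotAlg F} {k : B ⟶ D} (hk : f ≫ k = g ≫ k) :
    σ.q.f ≫ σ.s.f ≫ k.f = k.f := by
  have hk : f.f ≫ k.f = g.f ≫ k.f := congrArg FFGElgotAlg.Hom.f hk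
  rw [← Category.assoc, ← σ.t_f, Category.assoc, hk, ← Category.assoc, σ.t_g, Category.id_comp]

theorem sol_s_comp {D : FFGElgotAlg F} {k : B ⟶ D} (hk : f ≫ k = g ≫ k) {X : T.Algebra}
    (hX : IsFFG X) (e : X ⟶ F.obj X ⨿ Q.a) :
    D.sol hX (renameParams F (σ.s.f ≫ k.f) e) =
      (B.sol hX (renameParams F σ.s.f e) ≫ σ.q.f) ≫ σ.s.f ≫ k.f := by
  rw [renameParams_comp, k.preservesSol, Category.assoc, σ.q_s_comp hk]

/-- The morphism out of the split coequalizer induced by a coequalizing morphism. -/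
noncomputable def desc {D : FFGElgotAlg F} {k : B ⟶ D} (hk : f ≫ k = g ≫ k) : σ.elgot ⟶ D where
  f := σ.s.f ≫ k.f
  preservesSol := σ.sol_s_comp hk

theorem q_cancel {Z : T.Algebra} {m m' : Q.a ⟶ Z} (h : σ.q.f ≫ m = σ.q.f ≫ m') : m = m' := by
  rw [← Category.id_comp m, ← Category.id_comp m', ← σ.s_q, Category.assoc, h, Category.assoc]

/-- The split coequalizer lifts to a coequalizer of ffg-Elgot algebras. -/
noncomputable def isColimit : IsColimit (Cofork.ofπ σ.π σ.comp_π) :=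
  Cofork.IsColimit.mk _ (fun c => σ.desc c.condition)
    (fun c => elgot_hom_ext (σ.q_s_comp c.condition))
    (fun c _ hm => elgot_hom_ext <| σ.q_cancel <|
      (congrArg FFGElgotAlg.Hom.f hm).trans (σ.q_s_comp c.condition).symm)

end ElgotSplit

variable (hF : SolutionPreservingAreHoms F)

/-- The split coequalizer data of a pair split by the forgetful functor. -/
noncomputable def elgotSplitOfIsSplitPair {A B : FFGElgotAlg F} (f g : A ⟶ B)
    [(forgetToAlgebra hF).IsSplitPair f g] :
    ElgotSplit f g
      (HasSplitCoequalizer.coequalizerOfSplit ((forgetToAlgebra hF).map f)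
        ((forgetToAlgebra hF).map g)) :=
  let i := HasSplitCoequalizer.isSplitCoequalizer ((forgetToAlgebra hF).map f)
    ((forgetToAlgebra hF).map g)
  { q := HasSplitCoequalizer.coequalizerπ ((forgetToAlgebra hF).map f)
      ((forgetToAlgebra hF).map g)
    s := i.rightSection
    t := i.leftSection
    condition := congrArg Endofunctor.Algebra.Hom.f i.condition
    s_q := congrArg Endofunctor.Algebra.Hom.f i.rightSection_π
    t_g := congrArg Endofunctor.Algebra.Hom.f i.leftSection_bottom
    t_f := congrArg Endofunctor.Algebra.Hom.f i.leftSection_top }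

theorem preservesSol_of_inverse {A B : FFGElgotAlg F} (f : A ⟶ B) (g : B.alg.a ⟶ A.alg.a)
    (hfg : f.f ≫ g = 𝟙 _) (hgf : g ≫ f.f = 𝟙 _) {X : T.Algebra} (hX : IsFFG X)
    (e : X ⟶ F.obj X ⨿ B.alg.a) :
    A.sol hX (renameParams F g e) = B.sol hX e ≫ g := by
  have := f.preservesSol hX (renameParams F g e)
  rw [← renameParams_comp, hgf, renameParams_id] at this
  rw [this, Category.assoc, hfg, Category.comp_id]

instance reflectsIsomorphisms_forgetToAlgebra : (forgetToAlgebra hF).ReflectsIsomorphisms where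
  reflects {A B} f hf := by
    let g := inv ((forgetToAlgebra hF).map f)
    have hfg : f.f ≫ g.f = 𝟙 _ :=
      congrArg Endofunctor.Algebra.Hom.f (IsIso.hom_inv_id ((forgetToAlgebra hF).map f))
    have hgf : g.f ≫ f.f = 𝟙 _ :=
      congrArg Endofunctor.Algebra.Hom.f (IsIso.inv_hom_id ((forgetToAlgebra hF).map f))
    exact ⟨⟨⟨g.f, preservesSol_of_inverse f g.f hfg hgf⟩, elgot_hom_ext hfg, elgot_hom_ext hgf⟩⟩

theorem nonempty_monadicRightAdjoint [(forgetToAlgebra hF).IsRightAdjoint] :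
    Nonempty (MonadicRightAdjoint (forgetToAlgebra hF)) := by
  have : Monad.HasCoequalizerOfIsSplitPair (forgetToAlgebra hF) :=
    ⟨fun f g _ => ⟨⟨⟨_, (elgotSplitOfIsSplitPair hF f g).isColimit⟩⟩⟩⟩
  have : Monad.PreservesColimitOfIsSplitPair (forgetToAlgebra hF) := ⟨fun f g _ =>
    preservesColimit_of_preserves_colimit_cocone (elgotSplitOfIsSplitPair hF f g).isColimit
      ((isColimitMapCoconeCoforkEquiv _ _).symm
        (HasSplitCoequalizer.isSplitCoequalizer ((forgetToAlgebra hF).map f)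
          ((forgetToAlgebra hF).map g)).isCoequalizer)⟩
  exact ⟨Monad.monadicOfHasPreservesGSplitCoequalizersOfReflectsIsomorphisms
    (Adjunction.ofIsRightAdjoint (forgetToAlgebra hF))⟩

end Beck
-- Iteration terms and the solution set condition
section Solution

variable {S : Type u} {T : Monad (S → Type u)} {F : T.Algebra ⥤ T.Algebra}

/-- Formal iteration terms over a sorted set: a formal solution of an equation between finitely
generated free algebras, with terms substituted for its parameters. -/
inductive SolTerm (F : T.Algebra ⥤ T.Algebra) (B : S → Type u) : S → Type u
  | var {s : S} (b : B s) : SolTerm F B s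
  | sol (c d : Arity S) (e : T.free.obj c.set ⟶ F.obj (T.free.obj c.set) ⨿ T.free.obj d.set)
      (args : ∀ s, d.set s → SolTerm F B s) {s : S} (x : c.set s) : SolTerm F B s

theorem isFFG_arity (c : Arity S) : IsFFG (T.free.obj c.set) :=
  isFFG_free inferInstance

/-- The value of a term in an ffg-Elgot algebra. -/
noncomputable def SolTerm.eval (A : FFGElgotAlg F) {B : S → Type u} (h : ∀ s, B s → A.alg.a.A s) :
    ∀ s, SolTerm F B s → A.alg.a.A s
  | s, .var b => h s b
  | s, .sol c _ e args x =>
    (A.sol (isFFG_arity c) (renameParams F (freeLift fun s y => (args s y).eval A h) e)).f s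
      (gen x)

/-- The value homomorphism. -/
noncomputable def evalHom (A : FFGElgotAlg F) {B : T.Algebra} (h : B ⟶ A.alg.a) :
    T.free.obj (SolTerm F B.A) ⟶ A.alg.a :=
  freeLift (SolTerm.eval A fun s => h.f s)

theorem evalHom_var (A : FFGElgotAlg F) {B : T.Algebra} (h : B ⟶ A.alg.a) {s : S} (b : B.A s) :
    (evalHom A h).f s (gen (.var b)) = h.f s b := by
  rw [evalHom, freeLift_gen, SolTerm.eval]

theorem evalHom_sol (A : FFGElgotAlg F) {B : T.Algebra} (h : B ⟶ A.alg.a) (c d : Arity S)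
    (e : T.free.obj c.set ⟶ F.obj (T.free.obj c.set) ⨿ T.free.obj d.set)
    (args : ∀ s, d.set s → SolTerm F B.A s) {s : S} (x : c.set s) :
    (evalHom A h).f s (gen (.sol c d e args x)) =
      (A.sol (isFFG_arity c)
        (renameParams F (freeLift fun s y => (evalHom A h).f s (gen (args s y))) e)).f s
        (gen x) := by
  simp only [evalHom, freeLift_gen]
  rw [SolTerm.eval]

theorem eval_comp {A A' : FFGElgotAlg F} (f : A ⟶ A') {B : T.Algebra} (h : B ⟶ A.alg.a) (s : S)
    (t : SolTerm F B.A s) :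
    t.eval A' (fun s => (h ≫ f.f).f s) = f.f.f s (t.eval A fun s => h.f s) := by
  induction t with
  | var b => rfl
  | sol c d e args x ih =>
    rw [SolTerm.eval, SolTerm.eval, ← comp_apply, ← f.preservesSol, ← renameParams_comp,
      freeLift_comp]
    simp only [ih]

theorem evalHom_comp {A A' : FFGElgotAlg F} (f : A ⟶ A') {B : T.Algebra} (h : B ⟶ A.alg.a) :
    evalHom A' (h ≫ f.f) = evalHom A h ≫ f.f :=
  free_hom_ext fun s t => by
    rw [comp_apply, evalHom, evalHom, freeLift_gen, freeLift_gen, eval_comp]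

/-- A sortwise section `r` of `q` need not be a homomorphism, but `q' ∘ r` is one, since it does not
depend on the chosen preimages. -/
theorem exists_desc_of_surjective {P A A' : T.Algebra} {q : P ⟶ A} (q' : P ⟶ A')
    (hq : ∀ s, Function.Surjective (q.f s))
    (h : ∀ s x y, q.f s x = q.f s y → q'.f s x = q'.f s y) : ∃ φ : A ⟶ A', q ≫ φ = q' := by
  choose r hr using hq
  let r' : A.A ⟶ P.A := fun s => ↾(r s)
  have hr' : r' ≫ q.f = 𝟙 A.A := by
    funext s
    ext x
    exact hr s x
  have hφ : q.f ≫ r' ≫ q'.f = q'.f := by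
    funext s
    ext x
    exact h s _ _ (hr s _)
  refine ⟨⟨r' ≫ q'.f, ?_⟩, Monad.Algebra.Hom.ext hφ⟩
  rw [T.map_comp, Category.assoc, q'.h, ← hφ, ← q.h_assoc, ← T.map_comp_assoc, hr', hφ]
  simp

variable [PreservesFilteredColimits T.toFunctor]

/-- An equation with parameters in a quotient of a free algebra lifts to the free algebra. -/
theorem exists_lift_renameParams {X : T.Algebra} (hX : IsFFG X) {A : T.Algebra} {Z : S → Type u}
    {m : T.free.obj Z ⟶ A} (hm : ∀ s, Function.Surjective (m.f s)) (e : X ⟶ F.obj X ⨿ A) :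
    ∃ e' : X ⟶ F.obj X ⨿ T.free.obj Z, renameParams F m e' = e := by
  obtain ⟨c, i, e₀, rfl⟩ := exists_factor_coprod hX hm e
  exact ⟨renameParams F (T.free.map i) e₀, (renameParams_comp _ _ _).symm⟩

/-- The solution of an equation with terms as parameters is the value of a family of terms. -/
theorem exists_sol_terms {X : T.Algebra} (hX : IsFFG X) {B : T.Algebra}
    (e : X ⟶ F.obj X ⨿ T.free.obj (SolTerm F B.A)) :
    ∃ k : X ⟶ T.free.obj (SolTerm F B.A), ∀ (A : FFGElgotAlg F) (h : B ⟶ A.alg.a),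
      k ≫ evalHom A h = A.sol hX (renameParams F (evalHom A h) e) := by
  obtain ⟨d, i, e₀, rfl⟩ := exists_factor_coprod hX
    (m := 𝟙 (T.free.obj (SolTerm F B.A))) (fun s x => ⟨x, rfl⟩) e
  obtain ⟨c, ⟨j⟩⟩ := hX.exists_arity
  -- A term stores its equation over a coded domain, so `e₀` is transported along `j`.
  let e₁ := j.inv ≫ e₀ ≫ coprod.map (F.map j.hom) (𝟙 (T.free.obj d.set))
  refine ⟨j.hom ≫ freeLift fun s x => gen (.sol c d e₁ (fun s y => i s y) x), fun A h => ?_⟩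
  have hi : renameParams F (evalHom A h)
      (e₀ ≫ coprod.map (𝟙 (F.obj X)) (T.free.map i ≫ 𝟙 (T.free.obj (SolTerm F B.A)))) =
      renameParams F (T.free.map i ≫ evalHom A h) e₀ := by
    rw [Category.comp_id]
    exact (renameParams_comp _ _ _).symm
  rw [hi, A.sol_iso hX (isFFG_arity c) (isFFG_arity d) e₀ j, Category.assoc]
  congr 1
  refine free_hom_ext fun s x => ?_
  rw [comp_apply, freeLift_gen, evalHom_sol]
  have : (freeLift fun s (y : d.set s) => (evalHom A h).f s (gen (i s y))) =
      T.free.map i ≫ evalHom A h :=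
    free_hom_ext fun s y => by rw [freeLift_gen, comp_apply, map_gen]
  rw [this]

/-- The ffg-Elgot algebras generated by an `F`-algebra are determined by the kernel of the
evaluation of terms. -/
theorem exists_hom_of_kernel {A A' : FFGElgotAlg F} {B : T.Algebra} (h : B ⟶ A.alg.a)
    (h' : B ⟶ A'.alg.a) (hA : ∀ s, Function.Surjective ((evalHom A h).f s))
    (hk : ∀ s x y, (evalHom A h).f s x = (evalHom A h).f s y →
      (evalHom A' h').f s x = (evalHom A' h').f s y) :
    ∃ φ : A ⟶ A', h ≫ φ.f = h' := by
  obtain ⟨φ, hφ⟩ := exists_desc_of_surjective (evalHom A' h') hA hk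
  refine ⟨⟨φ, fun hX e => ?_⟩, ?_⟩
  · obtain ⟨e, rfl⟩ := exists_lift_renameParams hX hA e
    obtain ⟨k, hk⟩ := exists_sol_terms hX e
    rw [← renameParams_comp, hφ, ← hk, ← hk, Category.assoc, hφ]
  · refine hom_ext_apply fun s b => ?_
    rw [comp_apply, ← evalHom_var A h, ← comp_apply, hφ, evalHom_var]

theorem exists_sol_img (A : FFGElgotAlg F) {B : T.Algebra} (h : B ⟶ A.alg.a) {X : T.Algebra}
    (hX : IsFFG X) (e : X ⟶ F.obj X ⨿ img (evalHom A h)) :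
    ∃ k : X ⟶ img (evalHom A h),
      k ≫ imgIncl (evalHom A h) = A.sol hX (renameParams F (imgIncl (evalHom A h)) e) := by
  obtain ⟨q, hq, hs⟩ := exists_proj_img (evalHom A h)
  obtain ⟨e, rfl⟩ := exists_lift_renameParams hX hs e
  obtain ⟨k, hk⟩ := exists_sol_terms hX e
  exact ⟨k ≫ q, by rw [← renameParams_comp, Category.assoc, hq, hk]⟩

variable [PreservesSiftedColimits F]

/-- Closure under solutions gives closure under the structure: `applyEquation` exhibits each value
of the structure map as part of a solution. -/
theorem exists_str_img (A : FFGElgotAlg F) {B : T.Algebra} (h : B ⟶ A.alg.a) :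
    ∃ k : F.obj (img (evalHom A h)) ⟶ img (evalHom A h),
      k ≫ imgIncl (evalHom A h) = F.map (imgIncl (evalHom A h)) ≫ A.alg.str := by
  refine exists_lift_img _ _ fun s z => ?_
  obtain ⟨X, hX, p, w, rfl⟩ := exists_ffg_of_map F _ s z
  obtain ⟨t, ht⟩ := exists_elt T s
  have hY : IsFFG (freeOne T s) := isFFG_free inferInstance
  obtain ⟨k, hk⟩ := exists_sol_img A h (hX.coprod hY) (applyEquation p (elt w))
  rw [renameParams_applyEquation] at hk
  have key := congrArg (coprod.inr ≫ ·) hk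
  rw [A.inr_sol_applyEquation hX hY, F.map_comp] at key
  have := apply_of_eq key s t
  simp only [comp_apply, ht] at this
  obtain ⟨x, hx⟩ := imgIncl_mem (evalHom A h) s (k.f s ((coprod.inr : _ ⟶ X ⨿ _).f s t))
  exact ⟨x, hx.trans this⟩

/-- Every homomorphism from an `F`-algebra to an ffg-Elgot algebra factorizes through an ffg-Elgot
algebra generated by the `F`-algebra. -/
theorem exists_generated (A : FFGElgotAlg F) {B : Endofunctor.Algebra F} (h : B ⟶ A.alg) :
    ∃ (A' : FFGElgotAlg F) (h' : B ⟶ A'.alg) (i : A' ⟶ A), h'.f ≫ i.f = h.f ∧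
      ∀ s, Function.Surjective ((evalHom A' h'.f).f s) := by
  let i := imgIncl (evalHom A h.f)
  obtain ⟨str, hstr⟩ := exists_str_img A h.f
  choose sol hsol using fun (X : T.Algebra) (hX : IsFFG X)
    (e : X ⟶ F.obj X ⨿ img (evalHom A h.f)) => exists_sol_img A h.f hX e
  let U : Endofunctor.Algebra F := ⟨img (evalHom A h.f), str⟩
  let A' : FFGElgotAlg F := FFGElgotAlg.ofJointlyMono U (fun _ : Unit => A)
    (fun _ => ⟨i, hstr.symm⟩) (fun g g' w => (cancel_mono i).1 (w ())) (sol _)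
    (fun hX e _ => hsol _ hX e)
  let f : A' ⟶ A := ⟨i, fun hX e => (hsol _ hX e).symm⟩
  obtain ⟨k, hk⟩ := exists_lift_img (evalHom A h.f) h.f fun s b => ⟨_, evalHom_var A h.f b⟩
  obtain ⟨q, hq, hs⟩ := exists_proj_img (evalHom A h.f)
  have hF : F.map k ≫ str = B.str ≫ k := by
    rw [← cancel_mono i, Category.assoc, hstr, ← F.map_comp_assoc, hk, h.h, Category.assoc, hk]
  refine ⟨A', ⟨k, hF⟩, f, hk, ?_⟩
  have : evalHom A' k = q := by
    refine (cancel_mono i).1 ((evalHom_comp f k).symm.trans (Eq.trans ?_ hq.symm))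
    exact congrArg (evalHom A) hk
  rw [this]
  exact hs

theorem solutionSet_forgetToAlgebra (hF : SolutionPreservingAreHoms F) :
    SolutionSetCondition.{u} (forgetToAlgebra hF) := by
  intro B
  let P : T.Algebra := T.free.obj (SolTerm F B.a.A)
  let IsKernel (r : ∀ s, Setoid (P.A s)) (A : FFGElgotAlg F) (h : B ⟶ A.alg) : Prop :=
    (∀ s, Function.Surjective ((evalHom A h.f).f s)) ∧
      ∀ s x y, (r s).r x y ↔ (evalHom A h.f).f s x = (evalHom A h.f).f s y
  -- One generated algebra is chosen for each kernel that occurs; families of equivalence relations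
  -- on `P` form a small set.
  refine ⟨{r : ∀ s, Setoid (P.A s) // ∃ A h, IsKernel r A h}, fun r => r.2.choose,
    fun r => r.2.choose_spec.choose, fun A h => ?_⟩
  obtain ⟨A', h', i, hi, hs⟩ := exists_generated A h
  let r : {r : ∀ s, Setoid (P.A s) // ∃ A h, IsKernel r A h} :=
    ⟨fun s => Setoid.ker ((evalHom A' h'.f).f s), A', h', hs, fun _ _ _ => Iff.rfl⟩
  obtain ⟨hs₀, hr⟩ := r.2.choose_spec.choose_spec
  -- The chosen algebra and `A'` have the same kernel, so the former maps to `A'` under `B`.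
  obtain ⟨φ, hφ⟩ := exists_hom_of_kernel _ h'.f hs₀ fun s x y hxy => (hr s x y).2 hxy
  refine ⟨r, φ ≫ i, Endofunctor.Algebra.ext ?_⟩
  rw [← hi, ← hφ]
  exact (Category.assoc _ _ _).symm

end Solution
end FFGElgot

theorem mainTheorem9 {S : Type u} (T : Monad (S → Type u))
    [PreservesFilteredColimits T.toFunctor]
    (F : T.Algebra ⥤ T.Algebra) [FFGElgot.PreservesSiftedColimits F] :
    ∃ hF : FFGElgot.SolutionPreservingAreHoms F,
      Nonempty (MonadicRightAdjoint (FFGElgot.forgetToAlgebra hF)) := by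
  have hF : FFGElgot.SolutionPreservingAreHoms F := FFGElgot.solutionPreservingAreHoms
  have := FFGElgot.hasLimits_elgot hF
  have := FFGElgot.preservesLimits_forgetToAlgebra hF
  have := isRightAdjoint_of_preservesLimits_of_solutionSetCondition _
    (FFGElgot.solutionSet_forgetToAlgebra hF)
  exact ⟨hF, FFGElgot.nonempty_monadicRightAdjoint hF⟩
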